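/- **Notation.** $|\cdot|$ is the Euclidean norm on $\mathbb R^p$, $\|A\|=\max_{|x|=1}|Ax|$ is the operator norm of a real $p\times p$ matrix, $B(x,t)$ is the closed ball with centre $x$ and radius $t$, $B=B(0,1)$, and $\operatorname{co}$ is the convex hull. For a set $V$ of $p\times p$ matrices, $\|V\|_\infty=\sup_{A\in V}\|A\|\in[0,\infty]$; $V$ is invertible if each of its elements is, and then $V^{-1}=\{A^{-1}:A\in V\}$. At a point $x$ near which $f:\mathbb R^p\to\mathbb R^p$ is Lipschitz, the generalized Jacobian is $$\partial f(x)=\operatorname{co}\Big\{\lim_{n\to\infty} f'(x_n)\;:\; x_n\to x,\ f \text{ differentiable at every } x_n,\ \text{the limit exists}\Big\}.$$ **Proposition 4.1.** Let $f:\mathbb R^p\to\mathbb R^p$ be Lipschitz on a neighbourhood of $\xi_0\in\mathbb R^p$, and suppose that $\partial f(\xi_0)$ is invertible. Let $\lambda$ be a real number with $\lambda>\|\partial f(\xi_0)^{-1}\|_\infty$, and let $\delta_\lambda=\delta(\lambda;\partial f,\xi_0)$ be the supremum in $[0,\infty]$ of all $\delta>0$ such that, for every $t\in[0,\delta)$,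 $f$ is Lipschitz near each point of $B(\xi_0,t)$, the set $$\phi(t)=\operatorname{co}\bigcup_{x\in B(\xi_0,t)}\partial f(x)$$ is invertible, and $\|\phi(t)^{-1}\|_\infty\le\lambda$. Then $\delta_\lambda>0$; $$|f(\xi_0+h)-f(\xi_0)|\ \ge\ \frac1\lambda\,|h|\qquad\text{for every } h\in\mathbb R^p \text{ with } |h|<\delta_\lambda;$$ and $$f(\xi_0)+\frac{\delta}{2\lambda}B\ \subset\ f(\xi_0+\delta B)\qquad\text{for every real } \delta \text{ with } 0\le\delta<\delta_\lambda .$$ -/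

import Mathlib

open Filter Topology Set Metric

/-- The Euclidean space `ℝ^p`. Real `p × q` matrices are represented by the linear maps
`Eucl q →L[ℝ] Eucl p`, whose norm is the operator norm `max_{|x| = 1} |O x|`. -/
abbrev Eucl (p : ℕ) : Type := EuclideanSpace ℝ (Fin p)

/-- `f` is Lipschitz continuous on some neighbourhood of `x`. -/
def LipschitzNear {p q : ℕ} (f : Eucl q → Eucl p) (x : Eucl q) : Prop :=
  ∃ K : NNReal, ∃ U ∈ 𝓝 x, LipschitzOnWith K f U

/-- Clarke's generalized Jacobian: the convex hull of all limits of Jacobians `f'(x_n)` along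
sequences `x_n → x` of points of differentiability of `f`. It is meaningful at the points near
which `f` is Lipschitz. -/
def generalizedJacobian {p q : ℕ} (f : Eucl q → Eucl p) (x : Eucl q) :
    Set (Eucl q →L[ℝ] Eucl p) :=
  convexHull ℝ {P | ∃ u : ℕ → Eucl q, Tendsto u atTop (𝓝 x) ∧
    (∀ n, DifferentiableAt ℝ f (u n)) ∧
    Tendsto (fun n => fderiv ℝ f (u n)) atTop (𝓝 P)}

/-- The points at which the generalized Jacobian of `f` is defined. -/
def jacobianDomain {p q : ℕ} (f : Eucl q → Eucl p) : Set (Eucl q) :=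
  {x | LipschitzNear f x}

/-- A set of square matrices is invertible if each of its elements is. -/
def SetInvertible {p : ℕ} (V : Set (Eucl p →L[ℝ] Eucl p)) : Prop :=
  ∀ A ∈ V, IsUnit A

/-- The set of the inverses of the elements of `V`. -/
def setInverse {p : ℕ} (V : Set (Eucl p →L[ℝ] Eucl p)) : Set (Eucl p →L[ℝ] Eucl p) :=
  {B | ∃ A ∈ V, A * B = 1 ∧ B * A = 1}

/-- `‖V‖_∞ = sup_{A ∈ V} ‖A‖`, as an extended real (so it is `⊤` for unbounded `V`). -/
noncomputable def supNorm {p : ℕ} (V : Set (Eucl p →L[ℝ] Eucl p)) : EReal :=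
  ⨆ A ∈ V, ((‖A‖ : ℝ) : EReal)

/-- `φ(t; S, x) = co S(B(x, t))`, where `B(x, t)` is the closed ball, so `B(x, 0) = {x}`. -/
def hullOnBall {p : ℕ} (S : Eucl p → Set (Eucl p →L[ℝ] Eucl p)) (x : Eucl p) (t : ℝ) :
    Set (Eucl p →L[ℝ] Eucl p) :=
  convexHull ℝ (⋃ y ∈ closedBall x t, S y)

/-- `δ(lam; S, x)` for a set-valued map `S` defined on `D`: the supremum, in the extended reals,
of all `δ > 0` such that for every `t ∈ [0, δ)` the map `S` is defined on `B(x, t)`, the set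
`φ(t; S, x)` is invertible, and `‖φ(t; S, x)⁻¹‖_∞ ≤ lam`. -/
noncomputable def invertibilityRadius {p : ℕ} (lam : ℝ)
    (S : Eucl p → Set (Eucl p →L[ℝ] Eucl p)) (D : Set (Eucl p)) (x : Eucl p) : EReal :=
  sSup ((fun δ : ℝ => (δ : EReal)) '' {δ : ℝ | 0 < δ ∧ ∀ t ∈ Ico (0 : ℝ) δ,
    closedBall x t ⊆ D ∧ SetInvertible (hullOnBall S x t) ∧
    supNorm (setInverse (hullOnBall S x t)) ≤ (lam : EReal)})

/-! On a ball of radius less than `δlam`, every derivative of `f` lies in one closed convex set `C`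
of operators `A` with `‖v‖ ≤ lam * ‖A v‖`. Averaging `f` over small balls gives differentiable maps
`g`, uniformly close to `f`, with all derivatives still in `C`. For such `g` the mean value
inclusion gives the lower bound, and minimising `‖g - y‖ ^ 2` gives the covering; both survive the
uniform limit, the covering by compactness. Positivity of `δlam` follows from upper semicontinuity
of the generalized Jacobian: near `ξ₀` it stays in a thin convex thickening of its value at `ξ₀`,
where the lower bound holds with a slightly larger constant. -/

/-! ### Averaging and the mean value inclusion. -/

section BoundedBelow

variable {E F : Type*} [NormedAddCommGroup E] [NormedSpace ℝ E]
  [NormedAddCommGroup F] [NormedSpace ℝ F]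

/-- Averaging a Lipschitz function over small balls gives a uniformly close differentiable function
whose derivatives lie in any closed convex set that contains the derivatives of the function. -/
theorem LipschitzWith.exists_differentiable_approx [FiniteDimensional ℝ E] [FiniteDimensional ℝ F]
    {f : E → F} {K : NNReal} (hf : LipschitzWith K f)
    {C : Set (E →L[ℝ] F)} (hC : Convex ℝ C) (hCc : IsClosed C) {ξ : E} {r δ η : ℝ}
    (hδ : δ < r) (hη : 0 < η)
    (hfC : ∀ x ∈ ball ξ r, DifferentiableAt ℝ f x → fderiv ℝ f x ∈ C) :
    ∃ g : E → F, (∀ x, ‖g x - f x‖ ≤ η) ∧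
      ∀ x ∈ closedBall ξ δ, ∃ A ∈ C, HasFDerivAt g A x := by
  borelize E
  borelize F
  let vol : MeasureTheory.Measure E := MeasureTheory.Measure.addHaar
  have hK : (0 : ℝ) < K + 1 := by positivity
  -- The averaging radius: small enough to stay in `ball ξ r` and to move values by at most `η`; `K
  -- + 1` avoids dividing by zero.
  obtain ⟨ε, hε, hεδ, hεη⟩ : ∃ ε : ℝ, 0 < ε ∧ δ + ε ≤ r ∧ (K + 1) * ε ≤ η := by
    refine ⟨min (r - δ) (η / (K + 1)), lt_min (by linarith) (by positivity), ?_, ?_⟩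
    · linarith [min_le_left (r - δ) (η / (K + 1))]
    · calc _ ≤ ((K : ℝ) + 1) * (η / (K + 1)) := by gcongr; exact min_le_right _ _
        _ = η := by field_simp
  let μ : MeasureTheory.Measure E := ProbabilityTheory.cond vol (ball 0 ε)
  have hμp : MeasureTheory.IsProbabilityMeasure μ :=
    ProbabilityTheory.cond_isProbabilityMeasure_of_finite (measure_ball_pos vol 0 hε).ne'
      MeasureTheory.measure_ball_lt_top.ne
  have hμ : μ.AbsolutelyContinuous vol := ProbabilityTheory.cond_absolutelyContinuous
  have hball : ∀ᵐ z ∂μ, z ∈ ball (0 : E) ε := ProbabilityTheory.ae_cond_mem measurableSet_ball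
  have hcont : ∀ x, Continuous fun z => f (x + z) := fun x =>
    hf.continuous.comp (continuous_const.add continuous_id)
  have hmeas : ∀ x, MeasureTheory.AEStronglyMeasurable (fun z => f (x + z)) μ :=
    fun x => (hcont x).aestronglyMeasurable
  have hnear : ∀ x, ∀ᵐ z ∂μ, ‖f (x + z) - f x‖ ≤ η := by
    intro x
    filter_upwards [hball] with z hz
    have hz' : ‖z‖ < ε := by simpa using hz
    calc ‖f (x + z) - f x‖ ≤ K * ‖x + z - x‖ := hf.norm_sub_le _ _
      _ = K * ‖z‖ := by rw [add_sub_cancel_left]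
      _ ≤ (K + 1) * ε := by gcongr; linarith
      _ ≤ η := hεη
  have hint : ∀ x, MeasureTheory.Integrable (fun z => f (x + z)) μ := by
    intro x
    refine MeasureTheory.Integrable.of_bound (hmeas x) (‖f x‖ + η) ?_
    filter_upwards [hnear x] with z hz
    linarith [norm_le_norm_add_norm_sub' (f (x + z)) (f x)]
  refine ⟨fun x => ∫ z, f (x + z) ∂μ, fun x => ?_, fun x hx => ?_⟩
  · have : ∫ z, f (x + z) ∂μ - f x = ∫ z, (f (x + z) - f x) ∂μ := by
      rw [MeasureTheory.integral_sub (hint x) (MeasureTheory.integrable_const _)]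
      simp
    rw [this]
    simpa using MeasureTheory.norm_integral_le_of_norm_le_const (hnear x)
  -- Rademacher's theorem, translated by `x`.
  · have hdiff : ∀ᵐ z ∂μ, DifferentiableAt ℝ f (x + z) := by
      have h := hf.ae_differentiableAt (μ := vol)
      have h' := (MeasureTheory.quasiMeasurePreserving_add_left vol x).ae h
      exact hμ.ae_le h'
    have hder : ∀ᵐ z ∂μ, HasFDerivAt (fun y => f (y + z)) (fderiv ℝ f (x + z)) x := by
      filter_upwards [hdiff] with z hz
      exact (hasFDerivAt_comp_add_right z).2 hz.hasFDerivAt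
    obtain ⟨hi, hd⟩ := hasFDerivAt_integral_of_dominated_loc_of_lip (μ := μ) (𝕜 := ℝ)
      (F := fun y z => f (y + z)) (F' := fun z => fderiv ℝ f (x + z)) (x₀ := x)
      (bound := fun _ => (K : ℝ)) (s := univ) univ_mem
      (Eventually.of_forall hmeas) (hint x)
      (((measurable_fderiv ℝ f).comp (measurable_const_add x)).aestronglyMeasurable)
      (Eventually.of_forall fun z => by
        refine LipschitzOnWith.of_dist_le_mul fun y _ w _ => ?_
        simpa using hf.dist_le_mul (y + z) (w + z))
      (MeasureTheory.integrable_const _) hder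
    refine ⟨_, hC.integral_mem hCc ?_ hi, hd⟩
    filter_upwards [hdiff, hball] with z hz hzε
    refine hfC _ ?_ hz
    have hz' : ‖z‖ < ε := by simpa using hzε
    have hx' : ‖x - ξ‖ ≤ δ := by simpa [dist_eq_norm] using hx
    rw [mem_ball, dist_eq_norm, add_sub_right_comm]
    linarith [norm_add_le (x - ξ) z]

/-- A map whose derivatives on a convex set belong to a convex set of operators bounded below by
`lam⁻¹` is itself bounded below by `lam⁻¹` there. -/
theorem norm_sub_le_of_hasFDerivAt_mem {g : E → F} {C : Set (E →L[ℝ] F)} (hC : Convex ℝ C)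
    {lam : ℝ} (hlam : ∀ A ∈ C, ∀ v, ‖v‖ ≤ lam * ‖A v‖) {s : Set E} (hs : Convex ℝ s)
    (hg : ∀ x ∈ s, ∃ A ∈ C, HasFDerivAt g A x) {x y : E} (hx : x ∈ s) (hy : y ∈ s) :
    ‖y - x‖ ≤ lam * ‖g y - g x‖ := by
  let T : Set F := (fun A : E →L[ℝ] F => A (y - x)) '' C
  have hT : Convex ℝ T := hC.linear_image (ContinuousLinearMap.apply ℝ F (y - x)).toLinearMap
  -- Otherwise a functional strictly separates the increment from `T`, against the scalar mean value
  -- theorem.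
  have hmem : g y - g x ∈ closure T := by
    by_contra hn
    obtain ⟨l, u, hlu, hl⟩ := geometric_hahn_banach_point_closed hT.closure isClosed_closure hn
    choose! A hAC hA using hg
    obtain ⟨z, hz, h⟩ := domain_mvt (f := fun w => l (g w)) (f' := fun w => l.comp (A w))
      (fun w hw => (l.hasFDerivAt.comp w (hA w hw)).hasFDerivWithinAt) hs hx hy
    have hzs : z ∈ s := hs.segment_subset hx hy hz
    have := hl (A z (y - x)) (subset_closure ⟨_, hAC z hzs, rfl⟩)
    rw [map_sub] at hlu
    simp only [ContinuousLinearMap.comp_apply] at h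
    linarith
  have hcl : IsClosed {w : F | ‖y - x‖ ≤ lam * ‖w‖} :=
    isClosed_le continuous_const (continuous_const.mul continuous_norm)
  refine closure_minimal ?_ hcl hmem
  rintro _ ⟨A, hA, rfl⟩
  exact hlam A hA _

end BoundedBelow

/-! ### Covering by minimising the distance to the target. -/

section Surjective

variable {E : Type*} [NormedAddCommGroup E] [InnerProductSpace ℝ E] [FiniteDimensional ℝ E]

theorem ContinuousLinearMap.surjective_of_norm_le_mul {A : E →L[ℝ] E} {lam : ℝ}
    (hA : ∀ v, ‖v‖ ≤ lam * ‖A v‖) : Function.Surjective A := by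
  have hinj : Function.Injective A.toLinearMap := by
    rw [injective_iff_map_eq_zero]
    intro v hv
    have := hA v
    have hv' : A v = 0 := hv
    rw [hv'] at this
    simpa using this
  exact LinearMap.injective_iff_surjective.1 hinj

/-- A differentiable map with derivatives bounded below by `lam⁻¹` on a closed ball of radius `δ`
attains there every value at distance less than `δ / (2 * lam)` from the value at the centre. -/
theorem exists_mem_closedBall_eq_of_hasFDerivAt_mem {g : E → E} {C : Set (E →L[ℝ] E)}
    (hC : Convex ℝ C) {lam : ℝ} (hlam0 : 0 < lam) (hlam : ∀ A ∈ C, ∀ v, ‖v‖ ≤ lam * ‖A v‖)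
    {ξ : E} {δ : ℝ} (hg : ∀ x ∈ closedBall ξ δ, ∃ A ∈ C, HasFDerivAt g A x) (hδ : 0 ≤ δ)
    {y : E} (hy : ‖g ξ - y‖ < δ / (2 * lam)) : ∃ x ∈ closedBall ξ δ, g x = y := by
  have hξ : ξ ∈ closedBall ξ δ := mem_closedBall_self hδ
  have hcont : ContinuousOn g (closedBall ξ δ) := fun x hx => by
    obtain ⟨A, -, hA⟩ := hg x hx
    exact hA.continuousAt.continuousWithinAt
  obtain ⟨x, hx, hmin⟩ := (isCompact_closedBall ξ δ).exists_isMinOn ⟨ξ, hξ⟩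
    (((hcont.sub continuousOn_const).norm).pow 2 : ContinuousOn (fun x => ‖g x - y‖ ^ 2) _)
  refine ⟨x, hx, ?_⟩
  have hle : ‖g x - y‖ ≤ ‖g ξ - y‖ :=
    (sq_le_sq₀ (norm_nonneg _) (norm_nonneg _)).1 (hmin hξ)
  have hlow := norm_sub_le_of_hasFDerivAt_mem hC hlam (convex_closedBall ξ δ) hg hξ hx
  -- The minimiser is interior. The factor 2 in the radius is spent here: `g x` and `g ξ` are each
  -- within `δ / (2 * lam)` of `y`.
  have hlt : ‖x - ξ‖ < δ := by
    have h1 : ‖g x - g ξ‖ ≤ ‖g x - y‖ + ‖g ξ - y‖ := by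
      have := norm_sub_le (g x - y) (g ξ - y)
      rwa [sub_sub_sub_cancel_right] at this
    have h2 : ‖g x - g ξ‖ < δ / lam := by
      have : δ / lam = δ / (2 * lam) + δ / (2 * lam) := by field_simp; ring
      linarith
    calc ‖x - ξ‖ ≤ lam * ‖g x - g ξ‖ := hlow
      _ < lam * (δ / lam) := by gcongr
      _ = δ := by field_simp
  have hnhds : closedBall ξ δ ∈ 𝓝 x :=
    mem_of_superset (isOpen_ball.mem_nhds (by simpa [dist_eq_norm] using hlt))
      ball_subset_closedBall
  obtain ⟨A, hAC, hA⟩ := hg x hx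
  have hloc := (hmin.isLocalMin hnhds).hasFDerivAt_eq_zero ((hA.sub_const y).norm_sq)
  -- Testing criticality in a direction with `A v = g x - y` forces `g x - y` to be orthogonal to
  -- itself.
  obtain ⟨v, hv⟩ := ContinuousLinearMap.surjective_of_norm_le_mul (hlam A hAC) (g x - y)
  have h0 := DFunLike.congr_fun hloc v
  have h1 : inner ℝ (g x - y) (g x - y) = 0 := by
    simpa [hv, -inner_self_eq_norm_sq_to_K, inner_sub_left] using h0
  exact sub_eq_zero.1 (inner_self_eq_zero.1 h1)

/-- Lower bound and covering property of a Lipschitz map whose derivatives lie in a closed convex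
set of operators bounded below by `lam⁻¹`. -/
theorem LipschitzOnWith.norm_le_and_closedBall_subset_image {f : E → E} {K : NNReal} {ξ : E}
    {r δ lam : ℝ} (hf : LipschitzOnWith K f (ball ξ r)) {C : Set (E →L[ℝ] E)} (hC : Convex ℝ C)
    (hCc : IsClosed C) (hfC : ∀ x ∈ ball ξ r, DifferentiableAt ℝ f x → fderiv ℝ f x ∈ C)
    (hlam0 : 0 < lam) (hlam : ∀ A ∈ C, ∀ v, ‖v‖ ≤ lam * ‖A v‖) (hδ0 : 0 ≤ δ) (hδ : δ < r) :
    (∀ x ∈ closedBall ξ δ, ‖x - ξ‖ ≤ lam * ‖f x - f ξ‖) ∧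
      closedBall (f ξ) (δ / (2 * lam)) ⊆ f '' closedBall ξ δ := by
  -- Averaging is stated for globally Lipschitz maps; an extension has the same derivatives on the
  -- open ball.
  obtain ⟨F, hF, hFf⟩ : ∃ F : E → E, (∃ K', LipschitzWith K' F) ∧ EqOn f F (ball ξ r) := by
    obtain ⟨F, hF, hFf⟩ := hf.extend_finite_dimension
    exact ⟨F, ⟨_, hF⟩, hFf⟩
  obtain ⟨K', hF⟩ := hF
  have hFC : ∀ x ∈ ball ξ r, DifferentiableAt ℝ F x → fderiv ℝ F x ∈ C := by
    intro x hx hd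
    have he : f =ᶠ[𝓝 x] F := hFf.eventuallyEq_of_mem (isOpen_ball.mem_nhds hx)
    rw [← he.fderiv_eq]
    exact hfC x hx (he.differentiableAt_iff.2 hd)
  have hsub : closedBall ξ δ ⊆ ball ξ r := closedBall_subset_ball hδ
  have hξ : ξ ∈ closedBall ξ δ := mem_closedBall_self hδ0
  refine ⟨fun x hx => ?_, ?_⟩
  · rw [hFf (hsub hx), hFf (hsub hξ)]
    refine le_of_forall_pos_le_add fun η hη => ?_
    obtain ⟨g, hgF, hg⟩ := hF.exists_differentiable_approx hC hCc hδ
      (show 0 < η / (2 * lam) by positivity) hFC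
    have h1 := norm_sub_le_of_hasFDerivAt_mem hC hlam (convex_closedBall ξ δ) hg hξ hx
    have h2 : ‖g x - g ξ‖ ≤ ‖F x - F ξ‖ + η / lam := by
      have e : g x - g ξ = (F x - F ξ) + ((g x - F x) - (g ξ - F ξ)) := by abel
      have e2 : η / lam = η / (2 * lam) + η / (2 * lam) := by field_simp; ring
      rw [e]
      linarith [norm_add_le (F x - F ξ) ((g x - F x) - (g ξ - F ξ)),
        _root_.norm_sub_le (g x - F x) (g ξ - F ξ), hgF x, hgF ξ]
    calc ‖x - ξ‖ ≤ lam * ‖g x - g ξ‖ := h1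
      _ ≤ lam * (‖F x - F ξ‖ + η / lam) := by gcongr
      _ = lam * ‖F x - F ξ‖ + η := by field_simp
  · rw [(hFf.mono hsub).image_eq, hFf (hsub hξ)]
    have hclosed : IsClosed (F '' closedBall ξ δ) :=
      ((isCompact_closedBall ξ δ).image hF.continuous).isClosed
    rcases hδ0.eq_or_lt with rfl | hδpos
    · simp
    rw [← closure_ball _ (by positivity : δ / (2 * lam) ≠ 0)]
    refine closure_minimal (fun y hy => ?_) hclosed
    have hy' : ‖F ξ - y‖ < δ / (2 * lam) := by
      rwa [mem_ball, dist_comm, dist_eq_norm] at hy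
    refine hclosed.closure_eq ▸ Metric.mem_closure_iff.2 fun η hη => ?_
    obtain ⟨g, hgF, hg⟩ := hF.exists_differentiable_approx hC hCc hδ
      (η := min (η / 2) ((δ / (2 * lam) - ‖F ξ - y‖) / 2))
      (lt_min (by linarith) (by linarith)) hFC
    have hgy : ‖g ξ - y‖ < δ / (2 * lam) := by
      have := norm_add_le (g ξ - F ξ) (F ξ - y)
      rw [sub_add_sub_cancel] at this
      linarith [(hgF ξ).trans (min_le_right _ _)]
    obtain ⟨x, hx, rfl⟩ := exists_mem_closedBall_eq_of_hasFDerivAt_mem hC hlam0 hlam hg hδ0 hgy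
    refine ⟨F x, mem_image_of_mem _ hx, ?_⟩
    rw [dist_eq_norm]
    linarith [(hgF x).trans (min_le_left _ _)]

end Surjective

/-! ### Nonemptiness and upper semicontinuity. -/

section GeneralizedJacobian

variable {p q : ℕ} {f : Eucl q → Eucl p} {x : Eucl q}

theorem fderiv_mem_generalizedJacobian (h : DifferentiableAt ℝ f x) :
    fderiv ℝ f x ∈ generalizedJacobian f x :=
  subset_convexHull ℝ _ ⟨fun _ => x, tendsto_const_nhds, fun _ => h, tendsto_const_nhds⟩

theorem LipschitzNear.exists_subseq_tendsto_fderiv (hf : LipschitzNear f x) {u : ℕ → Eucl q}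
    (hu : Tendsto u atTop (𝓝 x)) (hd : ∀ n, DifferentiableAt ℝ f (u n)) :
    ∃ P ∈ generalizedJacobian f x, ∃ φ : ℕ → ℕ, StrictMono φ ∧
      Tendsto (fun n => fderiv ℝ f (u (φ n))) atTop (𝓝 P) := by
  have : ProperSpace (Eucl q →L[ℝ] Eucl p) := FiniteDimensional.proper ℝ _
  obtain ⟨K, U, hU, hK⟩ := hf
  have hev : ∀ᶠ n in atTop, fderiv ℝ f (u n) ∈ closedBall (0 : Eucl q →L[ℝ] Eucl p) K := by
    filter_upwards [hu.eventually (eventually_mem_nhds_iff.2 hU)] with n hn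
    simpa using norm_fderiv_le_of_lipschitzOn ℝ hn hK
  obtain ⟨P, -, φ, hφ, hP⟩ :=
    tendsto_subseq_of_frequently_bounded isBounded_closedBall hev.frequently
  exact ⟨P, subset_convexHull ℝ _ ⟨u ∘ φ, hu.comp hφ.tendsto_atTop, fun n => hd _, hP⟩,
    φ, hφ, hP⟩

theorem LipschitzNear.generalizedJacobian_nonempty (hf : LipschitzNear f x) :
    (generalizedJacobian f x).Nonempty := by
  have hf' := hf
  obtain ⟨K, U, hU, hK⟩ := hf'
  have hd : ∃ᶠ y in 𝓝 x, DifferentiableAt ℝ f y := by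
    rw [frequently_iff]
    intro V hV
    obtain ⟨W, hW, hWo, hxW⟩ := _root_.mem_nhds_iff.1 (inter_mem hU hV)
    by_contra! hn
    have hae := (hK.mono (hW.trans inter_subset_left)).ae_differentiableWithinAt_of_mem
      (μ := MeasureTheory.volume)
    -- Without points of differentiability in `W`, Rademacher's theorem would make this nonempty
    -- open set null.
    have h0 : MeasureTheory.volume W = 0 := by
      refine MeasureTheory.measure_mono_null (fun y hy => ?_) (MeasureTheory.ae_iff.1 hae)
      intro h
      exact hn y (hW hy).2 ((h hy).differentiableAt (hWo.mem_nhds hy))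
    exact (hWo.measure_pos _ ⟨x, hxW⟩).ne' h0
  obtain ⟨u, hu, hud⟩ := exists_seq_forall_of_frequently hd
  obtain ⟨P, hP, -⟩ := hf.exists_subseq_tendsto_fderiv hu hud
  exact ⟨P, hP⟩

/-- Upper semicontinuity of the generalized Jacobian. -/
theorem LipschitzNear.eventually_generalizedJacobian_subset (hf : LipschitzNear f x) {ε : ℝ}
    (hε : 0 < ε) :
    ∀ᶠ y in 𝓝 x, generalizedJacobian f y ⊆ cthickening ε (generalizedJacobian f x) := by
  have key : ∀ᶠ y in 𝓝 x, DifferentiableAt ℝ f y →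
      fderiv ℝ f y ∈ cthickening ε (generalizedJacobian f x) := by
    by_contra hn
    obtain ⟨u, hu, hun⟩ := exists_seq_forall_of_frequently (not_eventually.1 hn)
    push Not at hun
    obtain ⟨P, hP, φ, -, hφP⟩ := hf.exists_subseq_tendsto_fderiv hu fun n => (hun n).1
    obtain ⟨n, hn⟩ := (hφP.eventually (ball_mem_nhds P hε)).exists
    exact (hun (φ n)).2 (mem_cthickening_of_dist_le _ P ε _ hP (mem_ball.1 hn).le)
  -- The thickening is closed and convex, so it absorbs limits of derivatives and then their hull.
  filter_upwards [eventually_eventually_nhds.2 key] with y hy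
  refine convexHull_min ?_ ((convex_convexHull ℝ _).cthickening ε)
  rintro P ⟨u, hu, hd, hP⟩
  exact isClosed_cthickening.mem_of_tendsto hP ((hu.eventually hy).mono fun n hn => hn (hd n))

end GeneralizedJacobian

/-! ### Bounds on inverses as lower bounds on operators. -/

section Inverse

variable {p : ℕ} {V : Set (Eucl p →L[ℝ] Eucl p)} {lam : ℝ}

theorem norm_le_mul_norm_apply_of_supNorm_le (hV : SetInvertible V)
    (h : supNorm (setInverse V) ≤ (lam : EReal)) {A : Eucl p →L[ℝ] Eucl p} (hA : A ∈ V)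
    (v : Eucl p) : ‖v‖ ≤ lam * ‖A v‖ := by
  obtain ⟨B, hAB, hBA⟩ := isUnit_iff_exists.1 (hV A hA)
  have hB : ‖B‖ ≤ lam := EReal.coe_le_coe_iff.1 ((le_iSup₂ (f := fun (B : Eucl p →L[ℝ] Eucl p)
    (_ : B ∈ setInverse V) => ((‖B‖ : ℝ) : EReal)) B ⟨A, hA, hAB, hBA⟩).trans h)
  have hv : B (A v) = v := DFunLike.congr_fun hBA v
  calc ‖v‖ = ‖B (A v)‖ := by rw [hv]
    _ ≤ ‖B‖ * ‖A v‖ := B.le_opNorm _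
    _ ≤ lam * ‖A v‖ := by gcongr

theorem setInvertible_of_norm_le_mul_norm_apply (h : ∀ A ∈ V, ∀ v, ‖v‖ ≤ lam * ‖A v‖) :
    SetInvertible V := by
  intro A hA
  rw [ContinuousLinearMap.isUnit_iff_bijective]
  have hs := ContinuousLinearMap.surjective_of_norm_le_mul (h A hA)
  exact ⟨(LinearMap.injective_iff_surjective (f := A.toLinearMap)).2 hs, hs⟩

theorem supNorm_setInverse_le (hlam : 0 ≤ lam) (h : ∀ A ∈ V, ∀ v, ‖v‖ ≤ lam * ‖A v‖) :
    supNorm (setInverse V) ≤ (lam : EReal) := by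
  refine iSup₂_le ?_
  rintro B ⟨A, hA, hAB, -⟩
  refine EReal.coe_le_coe_iff.2 (B.opNorm_le_bound hlam fun w => ?_)
  have hw : A (B w) = w := DFunLike.congr_fun hAB w
  simpa [hw] using h A hA (B w)

/-- Nonemptiness matters: the supremum over the empty set is `⊥`, which says nothing about the sign
of `lam`. -/
theorem pos_of_supNorm_setInverse_lt (hne : V.Nonempty) (hV : SetInvertible V)
    (h : supNorm (setInverse V) < (lam : EReal)) : 0 < lam := by
  obtain ⟨A, hA⟩ := hne
  obtain ⟨B, hAB, hBA⟩ := isUnit_iff_exists.1 (hV A hA)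
  have hB : ‖B‖ < lam := EReal.coe_lt_coe_iff.1 ((le_iSup₂ (f := fun (B : Eucl p →L[ℝ] Eucl p)
    (_ : B ∈ setInverse V) => ((‖B‖ : ℝ) : EReal)) B ⟨A, hA, hAB, hBA⟩).trans_lt h)
  exact (norm_nonneg B).trans_lt hB

/-- A uniform lower bound persists, with a worse constant, on small thickenings. -/
theorem exists_cthickening_norm_le_mul_norm_apply {c : ℝ} (hc : 0 < c) (hcl : c < lam)
    (h : ∀ A ∈ V, ∀ v, ‖v‖ ≤ c * ‖A v‖) :
    ∃ ε > 0, ∀ A ∈ cthickening ε V, ∀ v, ‖v‖ ≤ lam * ‖A v‖ := by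
  have hlam : 0 < lam := hc.trans hcl
  have hpos : 0 < 1 - c / lam := by rw [sub_pos, div_lt_one hlam]; exact hcl
  -- A perturbation of size `(1 - c / lam) / c` turns the constant `c` into `lam`; half of it leaves
  -- room to pass to an open thickening.
  refine ⟨(1 - c / lam) / (2 * c), by positivity, fun A hA v => ?_⟩
  have hlt : (1 - c / lam) / (2 * c) < (1 - c / lam) / c :=
    div_lt_div_of_pos_left hpos hc (by linarith)
  obtain ⟨B, hB, hAB⟩ := mem_thickening_iff.1
    (cthickening_subset_thickening' (by positivity) hlt V hA)
  rw [dist_comm, dist_eq_norm] at hAB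
  have h1 : ‖B v‖ ≤ ‖A v‖ + (1 - c / lam) / c * ‖v‖ := by
    calc ‖B v‖ = ‖A v + (B - A) v‖ := by simp
      _ ≤ ‖A v‖ + ‖(B - A) v‖ := norm_add_le _ _
      _ ≤ ‖A v‖ + (1 - c / lam) / c * ‖v‖ := by
        gcongr
        exact (B - A).le_of_opNorm_le hAB.le v
  have h2 : ‖v‖ ≤ c * ‖A v‖ + (1 - c / lam) * ‖v‖ := by
    calc ‖v‖ ≤ c * ‖B v‖ := h B hB v
      _ ≤ c * (‖A v‖ + (1 - c / lam) / c * ‖v‖) := by gcongr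
      _ = _ := by field_simp
  have h3 : c / lam * ‖v‖ ≤ c * ‖A v‖ := by linarith
  calc ‖v‖ = lam / c * (c / lam * ‖v‖) := by field_simp
    _ ≤ lam / c * (c * ‖A v‖) := by gcongr
    _ = lam * ‖A v‖ := by field_simp

end Inverse

/-! ### The invertibility radius and the conclusion. -/

theorem exists_lipschitzOnWith_closedBall {p q : ℕ} {f : Eucl q → Eucl p} {x : Eucl q} {t : ℝ}
    (h : closedBall x t ⊆ jacobianDomain f) : ∃ K, LipschitzOnWith K f (closedBall x t) := by
  refine LocallyLipschitzOn.exists_lipschitzOnWith_of_compact (isCompact_closedBall x t) ?_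
  intro y hy
  obtain ⟨K, U, hU, hK⟩ := h hy
  exact ⟨K, U, mem_nhdsWithin_of_mem_nhds hU, hK⟩

theorem invertibilityRadius_generalizedJacobian_pos {p : ℕ} {f : Eucl p → Eucl p} {ξ : Eucl p}
    (hf : LipschitzNear f ξ) (hinv : SetInvertible (generalizedJacobian f ξ)) {lam : ℝ}
    (hlam : supNorm (setInverse (generalizedJacobian f ξ)) < (lam : EReal)) :
    0 < invertibilityRadius lam (generalizedJacobian f) (jacobianDomain f) ξ := by
  -- The gap between `c` and `lam` pays for the thickening.
  obtain ⟨c, hc, hcl⟩ := EReal.lt_iff_exists_real_btwn.1 hlam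
  have hc0 := pos_of_supNorm_setInverse_lt hf.generalizedJacobian_nonempty hinv hc
  have hcl' : c < lam := EReal.coe_lt_coe_iff.1 hcl
  obtain ⟨ε, hε, hbound⟩ := exists_cthickening_norm_le_mul_norm_apply hc0 hcl'
    fun A hA v => norm_le_mul_norm_apply_of_supNorm_le hinv hc.le hA v
  have hdom : ∀ᶠ y in 𝓝 ξ, LipschitzNear f y := by
    obtain ⟨K, U, hU, hK⟩ := hf
    filter_upwards [eventually_mem_nhds_iff.2 hU] with y hy
    exact ⟨K, U, hy, hK⟩
  obtain ⟨δ, hδ, hsub⟩ := Metric.eventually_nhds_iff_ball.1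
    (hdom.and (hf.eventually_generalizedJacobian_subset hε))
  refine lt_of_lt_of_le (EReal.coe_pos.2 hδ) (le_sSup (mem_image_of_mem _ ⟨hδ, fun t ht => ?_⟩))
  have htδ : closedBall ξ t ⊆ ball ξ δ := closedBall_subset_ball ht.2
  have hhull : ∀ A ∈ hullOnBall (generalizedJacobian f) ξ t, ∀ v, ‖v‖ ≤ lam * ‖A v‖ := by
    intro A hA
    refine hbound A (convexHull_min ?_ ((convex_convexHull ℝ _).cthickening ε) hA)
    exact iUnion₂_subset fun y hy => (hsub y (htδ hy)).2
  exact ⟨fun y hy => (hsub y (htδ hy)).1, setInvertible_of_norm_le_mul_norm_apply hhull,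
    supNorm_setInverse_le (hc0.trans hcl').le hhull⟩

theorem norm_le_and_closedBall_subset_image_of_lt_invertibilityRadius {p : ℕ}
    {f : Eucl p → Eucl p} {ξ : Eucl p} {lam δ : ℝ} (hlam : 0 < lam) (hδ0 : 0 ≤ δ)
    (hδ : (δ : EReal) < invertibilityRadius lam (generalizedJacobian f) (jacobianDomain f) ξ) :
    (∀ x ∈ closedBall ξ δ, ‖x - ξ‖ ≤ lam * ‖f x - f ξ‖) ∧
      closedBall (f ξ) (δ / (2 * lam)) ⊆ f '' closedBall ξ δ := by
  obtain ⟨_, ⟨r, ⟨-, hr⟩, rfl⟩, hδr⟩ := lt_sSup_iff.1 hδ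
  -- A radius `t > δ` leaves room for the averaging balls.
  obtain ⟨t, hδt, htr⟩ := exists_between (EReal.coe_lt_coe_iff.1 hδr)
  obtain ⟨hdom, hinv, hsup⟩ := hr t ⟨hδ0.trans hδt.le, htr⟩
  obtain ⟨K, hK⟩ := exists_lipschitzOnWith_closedBall hdom
  refine (hK.mono ball_subset_closedBall).norm_le_and_closedBall_subset_image
    (C := closure (hullOnBall (generalizedJacobian f) ξ t)) (convex_convexHull ℝ _).closure
    isClosed_closure (fun x hx hd => subset_closure (subset_convexHull ℝ _
      (mem_iUnion₂_of_mem (ball_subset_closedBall hx) (fderiv_mem_generalizedJacobian hd))))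
    hlam (fun A hA v => ?_) hδ0 hδt
  have hcl : IsClosed {A : Eucl p →L[ℝ] Eucl p | ‖v‖ ≤ lam * ‖A v‖} :=
    isClosed_le continuous_const (by fun_prop)
  exact closure_minimal (fun A hA => norm_le_mul_norm_apply_of_supNorm_le hinv hsup hA v) hcl hA

theorem proposition4p1 (p : ℕ) (f : Eucl p → Eucl p) (ξ₀ : Eucl p)
    (hf : LipschitzNear f ξ₀)
    (hinv : SetInvertible (generalizedJacobian f ξ₀))
    (lam : ℝ) (hlam : supNorm (setInverse (generalizedJacobian f ξ₀)) < (lam : EReal))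
    (δlam : EReal)
    (hδlam : δlam = invertibilityRadius lam (generalizedJacobian f) (jacobianDomain f) ξ₀) :
    0 < δlam ∧
    (∀ h : Eucl p, ((‖h‖ : ℝ) : EReal) < δlam → ‖f (ξ₀ + h) - f ξ₀‖ ≥ 1 / lam * ‖h‖) ∧
    (∀ δ : ℝ, 0 ≤ δ → (δ : EReal) < δlam →
      closedBall (f ξ₀) (δ / (2 * lam)) ⊆ f '' closedBall ξ₀ δ) := by
  subst hδlam
  have hlam0 := pos_of_supNorm_setInverse_lt hf.generalizedJacobian_nonempty hinv hlam
  refine ⟨invertibilityRadius_generalizedJacobian_pos hf hinv hlam, fun h hh => ?_,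
    fun δ hδ0 hδ =>
      (norm_le_and_closedBall_subset_image_of_lt_invertibilityRadius hlam0 hδ0 hδ).2⟩
  have hbound := (norm_le_and_closedBall_subset_image_of_lt_invertibilityRadius hlam0
    (norm_nonneg h) hh).1 (ξ₀ + h) (by simp)
  rw [add_sub_cancel_left] at hbound
  rw [ge_iff_le, one_div, inv_mul_le_iff₀ hlam0]
  exact hbound
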